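/- Let $\Omega\subset(0,\infty)$ be a finite set of states with a prior $p(\omega)>0$, $\sum_{\omega\in\Omega}p(\omega)=1$, and mean $\mathbb{E}(\omega)=\sum_{\omega}p(\omega)\,\omega$, and let $A_1\subset[0,\infty)$ be a finite set of offers. A seller makes an offer $a_1\in A_1$; a buyer with valuation $\omega$ observes the offer and accepts ($a_2=1$) or rejects ($a_2=0$). Payoffs (buyer, seller) are $(\omega-a_1,a_1)$ after acceptance and $(0,0)$ after rejection; initially neither party has any information about $\omega$ beyond $p$. A feedback rule is a pair $f=(f_1,f_2)$ with $f_1:\Omega\to A_1$ and $f_2:A_1\times\Omega\to\{0,1\}$; mediation ranges are a nonempty $R_1\subseteq A_1$ and nonempty $R_2(a_1)\subseteq\{0,1\}$ for each $a_1\in A_1$; $\mathcal{F}(R)$ is the set of feedback rules with $f_1(\omega)\in R_1$ and $f_2(a_1,\omega)\in R_2(a_1)$ for all $a_1,\omega$. A conditional probability system on a finite nonempty set $X$ assigns to each $Y\subseteq X$ and each nonempty $Z\subseteq X$ a number $\beta(Y|Z)\in[0,1]$ such that $\beta(Z|Z)=\beta(X|Z)=1$, $\beta(\cdot|Z)$ is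 additive on disjoint sets, and $\beta(Y|Z)=\beta(Y|W)\beta(W|Z)$ whenever $Y\subseteq W\subseteq Z$, $W\ne\emptyset$. A probability distribution $\mu$ over feedback rules is a sequential Bayes correlated equilibrium if there exist mediation ranges $R$ and a conditional probability system $\beta$ on $\mathcal{F}(R)\times A_1\times\{0,1\}\times\Omega$, with generic element $(f,a_1,a_2,\omega)$, such that: (i) for every $\hat a_1\in R_1$ and every $a_1\in A_1$, $$\sum_{f,\omega}f_1(\omega)f_2(f_1(\omega),\omega)\,\beta(f,\omega\,|\,f_1(\omega)=\hat a_1)\ \ge\ \sum_{f,\omega}a_1f_2(a_1,\omega)\,\beta(f,\omega\,|\,f_1(\omega)=\hat a_1);$$ (ii) for every $a_1\in A_1$ and every $\hat a_2\in R_2(a_1)$, with $E$ the event that the offer made is $a_1$ and $f_2(a_1,\omega)=\hat a_2$, $$\sum_{f,\omega}(\omega-a_1)f_2(a_1,\omega)\,\beta(f,\omega\,|\,E)\ \ge\ \sum_{f,\omega}(\omega-a_1)(1-f_2(a_1,\omega))\,\beta(f,\omega\,|\,E);$$ (iii) for all $f\in\mathcal{F}(R)$, $a_1$, $a_2$, $\omega$: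 $\beta(f,a_1,a_2,\omega)=\mu(f)p(\omega)\mathbf 1\{f_1(\omega)=a_1,\ f_2(f_1(\omega),\omega)=a_2\}$ and $\beta(f,a_1,a_2,\omega\,|\,f_1,a_1,\omega)=\beta(f\,|\,f_1,a_1,\omega)\,\mathbf 1\{f_2(a_1,\omega)=a_2\}$. Its payoff profile is the pair of expected payoffs (buyer, seller) under $\mu$ and $p$ when both players follow the recommendations. Let $\omega_L=\min\Omega$. Assume that $\mathbb{E}(\omega)\in A_1$ and that some offer in $A_1$ is strictly smaller than $\omega_L$, and let $\omega_L^-$ be the largest such offer. Then the set of payoff profiles (buyer, seller) of sequential Bayes correlated equilibria is $$\mathrm{co}\,\{(0,\omega_L^-),\ (0,\mathbb{E}(\omega)),\ (\mathbb{E}(\omega)-\omega_L^-,\ \omega_L^-)\}.$$ -/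

import Mathlib

/-- A conditional probability system on `X`: `prob A Z` is the probability of `A` given `Z`.
Only the values with `Z` nonempty are constrained, and only these are ever used. -/
structure CondProbSystem (X : Type*) where
  prob : Set X → Set X → ℝ
  nonneg : ∀ A Z : Set X, Z.Nonempty → 0 ≤ prob A Z
  le_one : ∀ A Z : Set X, Z.Nonempty → prob A Z ≤ 1
  self : ∀ Z : Set X, Z.Nonempty → prob Z Z = 1
  univ : ∀ Z : Set X, Z.Nonempty → prob Set.univ Z = 1
  union : ∀ A B Z : Set X, Z.Nonempty → A ∩ B = ∅ → prob (A ∪ B) Z = prob A Z + prob B Z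
  chain : ∀ A B Z : Set X, A ⊆ B → B ⊆ Z → B.Nonempty →
    prob A Z = prob A B * prob B Z

/-- The bargaining environment: a finite set of possible valuations (states) in `(0, ∞)`,
a finite set of offers in `[0, ∞)`, and a common prior that charges every state. -/
structure BargainingGame where
  states : Finset ℝ
  offers : Finset ℝ
  states_pos : ∀ ω ∈ states, 0 < ω
  offers_nonneg : ∀ a ∈ offers, 0 ≤ a
  prior : {ω // ω ∈ states} → ℝ
  prior_pos : ∀ ω, 0 < prior ω
  prior_sum : ∑ ω, prior ω = 1

namespace BargainingGame

/-- The states, as a type. -/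
abbrev State (G : BargainingGame) : Type := {ω : ℝ // ω ∈ G.states}

/-- The offers, as a type. -/
abbrev Offer (G : BargainingGame) : Type := {a : ℝ // a ∈ G.offers}

/-- The expected valuation. -/
noncomputable def mean (G : BargainingGame) : ℝ := ∑ ω : G.State, G.prior ω * (ω : ℝ)

/-- A feedback rule `f = (f₁, f₂)`: `f₁ ω` is the offer recommended to the seller in state `ω`,
and `f₂ a ω` is the reply (`true` = accept, `false` = reject) recommended to the buyer
after the offer `a` in state `ω`. -/
abbrev FeedbackRule (G : BargainingGame) : Type :=
  (G.State → G.Offer) × (G.Offer → G.State → Bool)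

/-- The value `1` of "accept" and `0` of "reject". -/
def acc (b : Bool) : ℝ := if b then 1 else 0

/-- Mediation ranges: the nonempty set of recommendations that can be made to the seller and,
after each offer, the nonempty set of recommendations that can be made to the buyer. -/
structure MediationRange (G : BargainingGame) where
  seller : Set G.Offer
  seller_nonempty : seller.Nonempty
  buyer : G.Offer → Set Bool
  buyer_nonempty : ∀ a, (buyer a).Nonempty

/-- The feedback rules consistent with the mediation ranges `R`. -/
abbrev RuleIn {G : BargainingGame} (R : G.MediationRange) : Type :=
  {f : G.FeedbackRule // (∀ ω, f.1 ω ∈ R.seller) ∧ ∀ a ω, f.2 a ω ∈ R.buyer a}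

/-- The space on which beliefs live: a consistent feedback rule and a terminal history
(the offer actually made, the reply actually given, and the state). -/
structure Terminal {G : BargainingGame} (R : G.MediationRange) where
  rule : RuleIn R
  offer : G.Offer
  reply : Bool
  state : G.State

variable {G : BargainingGame} {R : G.MediationRange}

/-- The marginal belief `β(f, ω | E)`. -/
def belief (β : CondProbSystem (Terminal R)) (E : Set (Terminal R))
    (f : RuleIn R) (ω : G.State) : ℝ :=
  β.prob {x | x.rule = f ∧ x.state = ω} E

/-- The event that the seller is recommended the offer `a`. -/
def sellerEvent (R : G.MediationRange) (a : G.Offer) : Set (Terminal R) :=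
  {x | x.rule.1.1 x.state = a}

/-- The event that the offer `a` is made and the buyer is recommended the reply `b`. -/
def buyerEvent (R : G.MediationRange) (a : G.Offer) (b : Bool) : Set (Terminal R) :=
  {x | x.offer = a ∧ x.rule.1.2 a x.state = b}

open Classical in
/-- The seller is obedient at every recommendation in his mediation range. -/
def SellerObedient (R : G.MediationRange) (β : CondProbSystem (Terminal R)) : Prop :=
  ∀ r ∈ R.seller, ∀ a : G.Offer,
    ∑ f : RuleIn R, ∑ ω : G.State,
        (a : ℝ) * acc (f.1.2 a ω) * belief β (sellerEvent R r) f ω ≤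
      ∑ f : RuleIn R, ∑ ω : G.State,
        (f.1.1 ω : ℝ) * acc (f.1.2 (f.1.1 ω) ω) * belief β (sellerEvent R r) f ω

open Classical in
/-- The buyer is obedient after every offer, at every recommendation in the mediation range. -/
def BuyerObedient (R : G.MediationRange) (β : CondProbSystem (Terminal R)) : Prop :=
  ∀ a : G.Offer, ∀ b ∈ R.buyer a,
    ∑ f : RuleIn R, ∑ ω : G.State,
        ((ω : ℝ) - a) * (1 - acc (f.1.2 a ω)) * belief β (buyerEvent R a b) f ω ≤
      ∑ f : RuleIn R, ∑ ω : G.State,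
        ((ω : ℝ) - a) * acc (f.1.2 a ω) * belief β (buyerEvent R a b) f ω

open Classical in
/-- The conditional probability system is consistent with the mechanism `μ`, the prior, and
obedient play. The first equation forces `μ` to be carried by the rules consistent with `R`;
in the second one, the conditioning event fixes the first component of the rule, the offer
made and the state. -/
def Consistent (R : G.MediationRange) (μ : G.FeedbackRule → ℝ)
    (β : CondProbSystem (Terminal R)) : Prop :=
  ∀ (f : RuleIn R) (a : G.Offer) (b : Bool) (ω : G.State),
    β.prob {⟨f, a, b, ω⟩} Set.univ
        = μ f.1 * G.prior ω * (if f.1.1 ω = a ∧ f.1.2 (f.1.1 ω) ω = b then 1 else 0) ∧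
    β.prob {⟨f, a, b, ω⟩} {x | x.rule.1.1 = f.1.1 ∧ x.offer = a ∧ x.state = ω}
        = β.prob {x | x.rule = f} {x | x.rule.1.1 = f.1.1 ∧ x.offer = a ∧ x.state = ω}
          * (if f.1.2 a ω = b then 1 else 0)

/-- A communication mechanism (a probability distribution over feedback rules) is a sequential
Bayes correlated equilibrium if, for some mediation ranges and some consistent conditional
probability system, both players are obedient. -/
def IsSBCE (G : BargainingGame) (μ : G.FeedbackRule → ℝ) : Prop :=
  μ ∈ stdSimplex ℝ G.FeedbackRule ∧
    ∃ (R : G.MediationRange) (β : CondProbSystem (Terminal R)),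
      SellerObedient R β ∧ BuyerObedient R β ∧ Consistent R μ β

/-- The buyer's expected payoff when the mechanism is `μ` and both players are obedient. -/
noncomputable def buyerPayoff (G : BargainingGame) (μ : G.FeedbackRule → ℝ) : ℝ :=
  ∑ f : G.FeedbackRule, ∑ ω : G.State,
    μ f * G.prior ω * (((ω : ℝ) - f.1 ω) * acc (f.2 (f.1 ω) ω))

/-- The seller's expected payoff when the mechanism is `μ` and both players are obedient. -/
noncomputable def sellerPayoff (G : BargainingGame) (μ : G.FeedbackRule → ℝ) : ℝ :=
  ∑ f : G.FeedbackRule, ∑ ω : G.State,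
    μ f * G.prior ω * ((f.1 ω : ℝ) * acc (f.2 (f.1 ω) ω))

/-- The (buyer, seller) payoff profiles of the sequential Bayes correlated equilibria. -/
def sbcePayoffs (G : BargainingGame) : Set (ℝ × ℝ) :=
  {v | ∃ μ : G.FeedbackRule → ℝ, G.IsSBCE μ ∧ v = (G.buyerPayoff μ, G.sellerPayoff μ)}

end BargainingGame

/-! The hull is the triangle of profiles (u, s) with u ≥ 0, s ≥ ω_L⁻ and u + s ≤ E(ω), by
`convexHull_triangle`.

Necessity. Multiplying obedience at an event by the probability of that event and summing over
recommendations gives an ex ante inequality. For the buyer told to accept this is u ≥ 0. For the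
seller, obedience is required even at null events, so no rule in the range can recommend rejecting
an offer below every valuation (`BuyerObedient.accepts`). Offering ω_L⁻ is thus a sure sale, whence
s ≥ ω_L⁻. Trade creates at most ω > 0 of surplus, whence the last bound.

Sufficiency. Three rules are mixed: sell at lo = ω_L⁻, sell at hi = E(ω), offer hi and have it
rejected. Their weights cA, cB, cC give the profile (cA (hi - lo), cA lo + cB hi), which covers the
triangle. The recommendation to the buyer at hi reveals nothing about the state, so she is
indifferent there. The seller told to offer hi could secure lo, so he obeys if (cB + cC) lo ≤ cB hi;
this is s ≥ lo rewritten. Every other offer above lo is at least ω_L, and is rejected in the belief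
that the state is ω_L. These beliefs come from a lexicographic sequence of weights (`tremble`), each
event being conditioned at the first level that charges it. -/

/-- The mass that a weight function gives to a set. -/
noncomputable def mass {X : Type*} [Fintype X] (w : X → ℝ) (A : Set X) : ℝ :=
  ∑ x, A.indicator w x

section Mass

variable {X : Type*} [Fintype X] {w : X → ℝ}

theorem mass_nonneg (hw : ∀ x, 0 ≤ w x) (A : Set X) : 0 ≤ mass w A :=
  Finset.sum_nonneg fun x _ => Set.indicator_nonneg (fun x _ => hw x) x

theorem mass_mono (hw : ∀ x, 0 ≤ w x) {A B : Set X} (h : A ⊆ B) : mass w A ≤ mass w B :=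
  Finset.sum_le_sum fun x _ => Set.indicator_le_indicator_of_subset h hw x

theorem mass_union {A B : Set X} (h : Disjoint A B) : mass w (A ∪ B) = mass w A + mass w B := by
  simp only [mass, ← Finset.sum_add_distrib, Set.indicator_union_of_disjoint h]

theorem mass_pos (hw : ∀ x, 0 ≤ w x) {A : Set X} {x : X} (hx : x ∈ A) (h : 0 < w x) :
    0 < mass w A := by
  refine Finset.sum_pos' (fun y _ => Set.indicator_nonneg (fun y _ => hw y) y)
    ⟨x, Finset.mem_univ x, ?_⟩
  rwa [Set.indicator_of_mem hx]

theorem mass_singleton_inter (x : X) (Z : Set X) : mass w ({x} ∩ Z) = Z.indicator w x := by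
  rw [mass, Finset.sum_eq_single x]
  · by_cases h : x ∈ Z <;> simp [h]
  · intro y _ hy
    simp [hy]
  · simp

end Mass

namespace CondProbSystem

/-! ### Elementary properties of conditional probability systems. -/

section General

variable {X : Type*} (β : CondProbSystem X) {Z : Set X}

theorem prob_empty (hZ : Z.Nonempty) : β.prob ∅ Z = 0 := by
  have := β.union ∅ ∅ Z hZ (by simp)
  simp only [Set.union_self] at this
  linarith

theorem prob_mono (hZ : Z.Nonempty) {A B : Set X} (h : A ⊆ B) : β.prob A Z ≤ β.prob B Z := by
  have h1 := β.union A (B \ A) Z hZ (by simp)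
  rw [Set.union_sdiff_cancel h] at h1
  linarith [β.nonneg (B \ A) Z hZ]

theorem prob_compl_self (hZ : Z.Nonempty) : β.prob Zᶜ Z = 0 := by
  have h1 := β.union Z Zᶜ Z hZ (by simp)
  rw [Set.union_compl_self, β.univ Z hZ, β.self Z hZ] at h1
  linarith

theorem prob_eq_zero_of_disjoint {A : Set X} (hZ : Z.Nonempty) (h : A ⊆ Zᶜ) :
    β.prob A Z = 0 :=
  le_antisymm ((β.prob_mono hZ h).trans (β.prob_compl_self hZ).le) (β.nonneg A Z hZ)

theorem prob_finset (hZ : Z.Nonempty) (s : Finset X) :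
    β.prob ↑s Z = ∑ x ∈ s, β.prob {x} Z := by
  classical
  induction s using Finset.induction_on with
  | empty => simpa using β.prob_empty hZ
  | insert x s hx ih =>
    rw [Finset.sum_insert hx, ← ih, ← β.union _ _ Z hZ (by simpa using hx), Finset.coe_insert,
      Set.insert_eq]

theorem prob_eq_mass [Fintype X] (hZ : Z.Nonempty) (A : Set X) :
    β.prob A Z = mass (fun x => β.prob {x} Z) A := by
  classical
  have := β.prob_finset hZ A.toFinset
  rw [Set.coe_toFinset] at this
  rw [this, mass, ← Finset.sum_indicator_subset _ (Finset.subset_univ A.toFinset)]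
  simp

/-- The chain rule in product form, with no division, so that it also covers null events. -/
theorem prob_singleton_mul (x : X) (hZ : Z.Nonempty) :
    β.prob {x} Z * β.prob Z Set.univ = Z.indicator (fun x => β.prob {x} Set.univ) x := by
  by_cases hx : x ∈ Z
  · rw [Set.indicator_of_mem hx]
    exact (β.chain {x} Z Set.univ (by simpa using hx) (Set.subset_univ _) hZ).symm
  · rw [Set.indicator_of_notMem hx, β.prob_eq_zero_of_disjoint hZ (by simpa using hx), zero_mul]

/-- A nonnegative conditional expectation has a nonnegative unnormalized counterpart. -/
theorem sum_indicator_nonneg [Fintype X] (hZ : Z.Nonempty) (g : X → ℝ)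
    (h : 0 ≤ ∑ x, β.prob {x} Z * g x) :
    0 ≤ ∑ x, Z.indicator (fun x => β.prob {x} Set.univ) x * g x := by
  have : ∑ x, Z.indicator (fun x => β.prob {x} Set.univ) x * g x
      = β.prob Z Set.univ * ∑ x, β.prob {x} Z * g x := by
    rw [Finset.mul_sum]
    refine Finset.sum_congr rfl fun x _ => ?_
    rw [← β.prob_singleton_mul x hZ]
    ring
  rw [this]
  exact mul_nonneg (β.nonneg _ _ (hZ.mono (Set.subset_univ _))) h

end General

/-! ### Conditional probability systems from sequences of weights. -/

section Lexicographic

variable {X : Type*} [Fintype X]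

/-- The first index whose weight function charges `Z`. -/
noncomputable def level (m : ℕ → X → ℝ) (Z : Set X) : ℕ := sInf {i | 0 < mass (m i) Z}

theorem level_le {m : ℕ → X → ℝ} {Z : Set X} {k : ℕ} (hk : 0 < mass (m k) Z) :
    level m Z ≤ k := Nat.sInf_le hk

theorem mass_level_pos {m : ℕ → X → ℝ} {Z : Set X} {k : ℕ} (hk : 0 < mass (m k) Z) :
    0 < mass (m (level m Z)) Z := Nat.sInf_mem (s := {i | 0 < mass (m i) Z}) ⟨k, hk⟩

/-- The conditional probability system induced by a sequence of weight functions, one of which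
has full support: condition the first one that charges the event. -/
noncomputable def lexicographic (m : ℕ → X → ℝ) (hm : ∀ i x, 0 ≤ m i x) (n : ℕ)
    (hn : ∀ x, 0 < m n x) : CondProbSystem X :=
  have pos : ∀ Z : Set X, Z.Nonempty → 0 < mass (m (level m Z)) Z := fun _ ⟨x, hx⟩ =>
    mass_level_pos (mass_pos (hm n) hx (hn x))
  { prob := fun A Z => mass (m (level m Z)) (A ∩ Z) / mass (m (level m Z)) Z
    nonneg := fun _ _ _ => div_nonneg (mass_nonneg (hm _) _) (mass_nonneg (hm _) _)
    le_one := fun _ _ _ => div_le_one_of_le₀ (mass_mono (hm _) Set.inter_subset_right)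
      (mass_nonneg (hm _) _)
    self := fun Z hZ => by rw [Set.inter_self, div_self (pos Z hZ).ne']
    univ := fun Z hZ => by rw [Set.univ_inter, div_self (pos Z hZ).ne']
    union := fun A B Z _ h => by
      rw [Set.union_inter_distrib_right, mass_union, add_div]
      exact (Set.disjoint_iff_inter_eq_empty.2 h).mono Set.inter_subset_left Set.inter_subset_left
    chain := fun A B Z hAB hBZ hB => by
      rw [Set.inter_eq_left.2 hAB, Set.inter_eq_left.2 hBZ, Set.inter_eq_left.2 (hAB.trans hBZ)]
      -- If the level of `Z` does not charge `B`, it does not charge `A` and both sides vanish;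
      -- otherwise `B` and `Z` share that level and the quotients telescope.
      rcases (mass_nonneg (hm (level m Z)) B).eq_or_lt with h | h
      · have hA : mass (m (level m Z)) A = 0 :=
          le_antisymm ((mass_mono (hm _) hAB).trans h.symm.le) (mass_nonneg (hm _) _)
        rw [hA, ← h, zero_div, mul_zero]
      · have hl : level m B = level m Z := by
          refine le_antisymm (level_le h) (level_le ?_)
          exact (pos B hB).trans_le (mass_mono (hm _) hBZ)
        rw [hl, div_mul_div_cancel₀ h.ne'] }

variable {m : ℕ → X → ℝ} {hm : ∀ i x, 0 ≤ m i x} {n : ℕ} {hn : ∀ x, 0 < m n x}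

theorem lexicographic_prob (A Z : Set X) : (lexicographic m hm n hn).prob A Z =
    mass (m (level m Z)) (A ∩ Z) / mass (m (level m Z)) Z := rfl

/-- The level actually used is at most any `k` that charges `Z`, so it need not be identified: it
suffices to check all levels up to `k`. -/
theorem lexicographic_expect_nonneg {Z : Set X} {g : X → ℝ} (k : ℕ) (hk : 0 < mass (m k) Z)
    (h : ∀ i ≤ k, 0 ≤ ∑ x, Z.indicator (m i) x * g x) :
    0 ≤ ∑ x, (lexicographic m hm n hn).prob {x} Z * g x := by
  have : ∑ x, (lexicographic m hm n hn).prob {x} Z * g x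
      = (∑ x, Z.indicator (m (level m Z)) x * g x) / mass (m (level m Z)) Z := by
    rw [Finset.sum_div]
    refine Finset.sum_congr rfl fun x _ => ?_
    rw [lexicographic_prob, mass_singleton_inter]
    ring
  rw [this]
  exact div_nonneg (h _ (level_le hk)) (mass_nonneg (hm _) _)

end Lexicographic

end CondProbSystem

/-! ### Sums over terminal histories, and obedience as a sign condition. -/

namespace BargainingGame

section

open Classical

variable {G : BargainingGame} {R : G.MediationRange}

/-- A terminal history as a tuple. -/
def Terminal.equivProd (R : G.MediationRange) :
    Terminal R ≃ RuleIn R × G.State × G.Offer × Bool where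
  toFun x := (x.rule, x.state, x.offer, x.reply)
  invFun y := ⟨y.1, y.2.2.1, y.2.2.2, y.2.1⟩
  left_inv _ := rfl
  right_inv _ := rfl

noncomputable instance (R : G.MediationRange) : Fintype (Terminal R) :=
  Fintype.ofEquiv _ (Terminal.equivProd R).symm

theorem sum_terminal (F : Terminal R → ℝ) :
    ∑ x, F x = ∑ f : RuleIn R, ∑ ω : G.State, ∑ a : G.Offer, ∑ b : Bool, F ⟨f, a, b, ω⟩ := by
  rw [← Equiv.sum_comp (Terminal.equivProd R).symm F]
  simp only [Fintype.sum_prod_type]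
  rfl

theorem sum_belief (β : CondProbSystem (Terminal R)) {E : Set (Terminal R)} (hE : E.Nonempty)
    (h : RuleIn R → G.State → ℝ) :
    ∑ f : RuleIn R, ∑ ω : G.State, h f ω * belief β E f ω
      = ∑ x, β.prob {x} E * h x.rule x.state := by
  rw [sum_terminal]
  refine Finset.sum_congr rfl fun f _ => Finset.sum_congr rfl fun ω _ => ?_
  rw [belief, β.prob_eq_mass hE, mass, sum_terminal, Finset.sum_eq_single f,
    Finset.sum_eq_single ω]
  · simp only [Set.indicator, Set.mem_ofPred_eq, and_self, if_true, Finset.mul_sum]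
    simp only [mul_comm]
  · intro ω' _ hω
    simp [Set.indicator, hω]
  · simp
  · intro f' _ hf
    simp [Set.indicator, hf]
  · simp

/-- The weights of terminal histories when rules have weights `c` and both players obey. -/
noncomputable def onPath (R : G.MediationRange) (c : G.FeedbackRule → ℝ) (x : Terminal R) : ℝ :=
  c x.rule.1 * G.prior x.state *
    (if x.rule.1.1 x.state = x.offer ∧ x.rule.1.2 (x.rule.1.1 x.state) x.state = x.reply
      then 1 else 0)

theorem onPath_nonneg {c : G.FeedbackRule → ℝ} (hc : ∀ f, 0 ≤ c f) (x : Terminal R) :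
    0 ≤ onPath R c x := by
  unfold onPath
  have := hc x.rule.1
  have := (G.prior_pos x.state).le
  positivity

theorem onPath_pos {c : G.FeedbackRule → ℝ} {f : RuleIn R} (hf : 0 < c f.1) (ω : G.State) :
    0 < onPath R c ⟨f, f.1.1 ω, f.1.2 (f.1.1 ω) ω, ω⟩ := by
  simpa [onPath] using mul_pos hf (G.prior_pos ω)

theorem sum_onPath (c : G.FeedbackRule → ℝ) (g : G.FeedbackRule → G.Offer → G.State → ℝ) :
    ∑ x : Terminal R, onPath R c x * g x.rule.1 x.offer x.state
      = ∑ f : RuleIn R, ∑ ω : G.State, c f.1 * G.prior ω * g f.1 (f.1.1 ω) ω := by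
  rw [sum_terminal]
  refine Finset.sum_congr rfl fun f _ => Finset.sum_congr rfl fun ω _ => ?_
  rw [Finset.sum_eq_single (f.1.1 ω), Finset.sum_eq_single (f.1.2 (f.1.1 ω) ω)]
  · simp [onPath]
  · intro b _ hb
    simp [onPath, hb.symm]
  · simp
  · intro a _ ha
    simp [onPath, ha.symm]
  · simp

theorem sellerEvent_nonempty [Nonempty G.State] {r : G.Offer} (hr : r ∈ R.seller) :
    (sellerEvent R r).Nonempty := by
  obtain ⟨ω⟩ := ‹Nonempty G.State›
  choose b hb using R.buyer_nonempty
  exact ⟨⟨⟨(fun _ => r, fun a _ => b a), fun _ => hr, fun a _ => hb a⟩, r, true, ω⟩, rfl⟩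

/-- Shows that every admissible recommendation to the buyer is compatible with every state, in
particular with the lowest one. -/
theorem exists_rule_reply {a : G.Offer} {b : Bool} (hb : b ∈ R.buyer a) :
    ∃ f : RuleIn R, ∀ ω, f.1.2 a ω = b := by
  choose b' hb' using R.buyer_nonempty
  obtain ⟨r, hr⟩ := R.seller_nonempty
  refine ⟨⟨(fun _ => r, fun a' _ => if a' = a then b else b' a'), fun _ => hr, ?_⟩, ?_⟩
  · intro a' _
    by_cases h : a' = a
    · simpa [h] using hb
    · simpa [h] using hb' a'
  · simp

theorem buyerEvent_nonempty [Nonempty G.State] {a : G.Offer} {b : Bool} (hb : b ∈ R.buyer a) :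
    (buyerEvent R a b).Nonempty := by
  obtain ⟨ω⟩ := ‹Nonempty G.State›
  obtain ⟨f, hf⟩ := exists_rule_reply hb
  exact ⟨⟨f, a, b, ω⟩, rfl, hf ω⟩

/-- The seller's gain from obeying rather than offering `a`. -/
def sellerGain (a : G.Offer) (f : G.FeedbackRule) (ω : G.State) : ℝ :=
  (f.1 ω : ℝ) * acc (f.2 (f.1 ω) ω) - (a : ℝ) * acc (f.2 a ω)

/-- The buyer's gain from obeying rather than giving the opposite reply to `a`. -/
def buyerGain (a : G.Offer) (f : G.FeedbackRule) (ω : G.State) : ℝ :=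
  ((ω : ℝ) - a) * acc (f.2 a ω) - ((ω : ℝ) - a) * (1 - acc (f.2 a ω))

theorem sellerObedient_iff [Nonempty G.State] (β : CondProbSystem (Terminal R)) :
    SellerObedient R β ↔ ∀ r ∈ R.seller, ∀ a : G.Offer,
      0 ≤ ∑ x, β.prob {x} (sellerEvent R r) * sellerGain a x.rule.1 x.state := by
  refine forall₂_congr fun r hr => forall_congr' fun a => ?_
  rw [sum_belief β (sellerEvent_nonempty hr)
      (fun f ω => (a : ℝ) * acc (f.1.2 a ω)),
    sum_belief β (sellerEvent_nonempty hr)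
      (fun f ω => (f.1.1 ω : ℝ) * acc (f.1.2 (f.1.1 ω) ω)), ← sub_nonneg,
    ← Finset.sum_sub_distrib]
  simp only [sellerGain, mul_sub]

theorem buyerObedient_iff [Nonempty G.State] (β : CondProbSystem (Terminal R)) :
    BuyerObedient R β ↔ ∀ a : G.Offer, ∀ b ∈ R.buyer a,
      0 ≤ ∑ x, β.prob {x} (buyerEvent R a b) * buyerGain a x.rule.1 x.state := by
  refine forall_congr' fun a => forall₂_congr fun b hb => ?_
  rw [sum_belief β (buyerEvent_nonempty hb)
      (fun f ω => ((ω : ℝ) - a) * (1 - acc (f.1.2 a ω))),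
    sum_belief β (buyerEvent_nonempty hb)
      (fun f ω => ((ω : ℝ) - a) * acc (f.1.2 a ω)), ← sub_nonneg,
    ← Finset.sum_sub_distrib]
  simp only [buyerGain, mul_sub]

theorem acc_le_one (b : Bool) : acc b ≤ 1 := by cases b <;> simp [acc]

/-! ### Bounds on equilibrium payoffs -/

theorem Consistent.prob_eq_onPath {μ : G.FeedbackRule → ℝ} {β : CondProbSystem (Terminal R)}
    (h : Consistent R μ β) : (fun x => β.prob {x} Set.univ) = onPath R μ := by
  funext x
  exact (h x.rule x.offer x.reply x.state).1

/-- The beliefs have total mass one and live on rules in the range, so `μ` has mass one there and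
vanishes elsewhere. -/
theorem Consistent.support [Nonempty G.State] {μ : G.FeedbackRule → ℝ}
    {β : CondProbSystem (Terminal R)} (h : Consistent R μ β)
    (hμ : μ ∈ stdSimplex ℝ G.FeedbackRule) (g : G.FeedbackRule → ℝ) :
    ∑ f : RuleIn R, μ f.1 * g f.1 = ∑ f : G.FeedbackRule, μ f * g f := by
  obtain ⟨r, hr⟩ := R.seller_nonempty
  have hne : (Set.univ : Set (Terminal R)).Nonempty :=
    (sellerEvent_nonempty hr).mono (Set.subset_univ _)
  have h1 : ∑ f : RuleIn R, μ f.1 = 1 := by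
    have := β.univ _ hne
    rw [β.prob_eq_mass hne, h.prob_eq_onPath, mass] at this
    simp only [Set.indicator_univ] at this
    have h2 := sum_onPath (R := R) μ (fun _ _ _ => 1)
    simp only [mul_one, this, ← Finset.mul_sum, G.prior_sum] at h2
    exact h2.symm
  set P : G.FeedbackRule → Prop :=
    fun f => (∀ ω, f.1 ω ∈ R.seller) ∧ ∀ a ω, f.2 a ω ∈ R.buyer a
  have key : ∀ k : G.FeedbackRule → ℝ,
      ∑ f : RuleIn R, k f.1 = ∑ f ∈ Finset.univ.filter P, k f := fun k =>
    (Finset.sum_subtype (Finset.univ.filter P) (p := P) (by simp) k).symm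
  have h3 : ∑ f ∈ Finset.univ.filter (fun f => ¬ P f), μ f = 0 := by
    have := Finset.sum_filter_add_sum_filter_not Finset.univ P μ
    rw [hμ.2, ← key, h1] at this
    linarith
  rw [Finset.sum_eq_zero_iff_of_nonneg fun f _ => hμ.1 f] at h3
  rw [key fun f => μ f * g f, ← Finset.sum_filter_add_sum_filter_not Finset.univ P,
    Finset.sum_eq_zero (s := Finset.univ.filter fun f => ¬ P f) fun f hf => by
      rw [h3 f hf, zero_mul], add_zero]

theorem Consistent.sum_onPath_eq [Nonempty G.State] {μ : G.FeedbackRule → ℝ}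
    {β : CondProbSystem (Terminal R)} (h : Consistent R μ β)
    (hμ : μ ∈ stdSimplex ℝ G.FeedbackRule) (g : G.FeedbackRule → G.Offer → G.State → ℝ) :
    ∑ x : Terminal R, onPath R μ x * g x.rule.1 x.offer x.state
      = ∑ f : G.FeedbackRule, ∑ ω : G.State, μ f * G.prior ω * g f (f.1 ω) ω := by
  rw [sum_onPath]
  simp only [mul_assoc, ← Finset.mul_sum]
  exact h.support hμ fun f => ∑ ω, G.prior ω * g f (f.1 ω) ω

/-- Offers below every state are never rejected. -/
theorem BuyerObedient.accepts [Nonempty G.State] {β : CondProbSystem (Terminal R)}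
    (h : BuyerObedient R β) {a : G.Offer} (ha : ∀ ω : G.State, (a : ℝ) < ω) :
    false ∉ R.buyer a := by
  intro hb
  have h1 := (buyerObedient_iff β).1 h a false hb
  have hne := buyerEvent_nonempty hb
  set E := buyerEvent R a false
  have hsum : ∑ x, β.prob {x} E = 1 := by
    rw [← β.univ E hne, β.prob_eq_mass hne, mass]
    simp
  obtain ⟨x, -, hx⟩ : ∃ x ∈ (Finset.univ : Finset (Terminal R)), 0 < β.prob {x} E :=
    Finset.exists_lt_of_sum_lt (f := fun _ => (0 : ℝ)) (by rw [hsum]; simp)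
  -- Obeying a rejection forgoes ω - a > 0 at every point of the event, so the expected gain is
  -- negative under any belief.
  have term : ∀ y ∈ E, buyerGain a y.rule.1 y.state < 0 := by
    rintro y ⟨-, hy⟩
    simp only [buyerGain, hy, acc]
    simpa using ha y.state
  have hzero : ∀ y ∉ E, β.prob {y} E = 0 := fun y hy =>
    β.prob_eq_zero_of_disjoint hne (by simpa using hy)
  refine absurd h1 (not_le.2 (Finset.sum_neg' (fun y _ => ?_) ⟨x, Finset.mem_univ x, ?_⟩))
  · by_cases hy : y ∈ E
    · exact mul_nonpos_of_nonneg_of_nonpos (β.nonneg _ _ hne) (term y hy).le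
    · rw [hzero y hy, zero_mul]
  · refine mul_neg_of_pos_of_neg hx (term x ?_)
    by_contra hxE
    exact hx.ne' (hzero x hxE)

/-- Every rule in the range accepts `a`, so deviating to `a` after each recommendation earns exactly
`a`; the obedience inequalities are added over recommendations. -/
theorem le_sellerPayoff [Nonempty G.State] {μ : G.FeedbackRule → ℝ} (h : G.IsSBCE μ)
    {a : G.Offer} (ha : ∀ ω : G.State, (a : ℝ) < ω) : (a : ℝ) ≤ G.sellerPayoff μ := by
  obtain ⟨hμ, R, β, hs, hb, hc⟩ := h
  have hacc : ∀ (f : RuleIn R) ω, f.1.2 a ω = true := fun f ω => by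
    have := f.2.2 a ω
    cases h : f.1.2 a ω
    · exact absurd (h ▸ this) (hb.accepts ha)
    · rfl
  have h1 : ∀ r : G.Offer, 0 ≤ ∑ x : Terminal R,
      (sellerEvent R r).indicator (onPath R μ) x * sellerGain a x.rule.1 x.state := by
    intro r
    by_cases hr : r ∈ R.seller
    · rw [← hc.prob_eq_onPath]
      exact β.sum_indicator_nonneg (sellerEvent_nonempty hr) _ ((sellerObedient_iff β).1 hs r hr a)
    · refine Finset.sum_nonneg fun x _ => ?_
      have : x ∉ sellerEvent R r := fun hx => hr (hx ▸ x.rule.2.1 x.state)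
      simp [this]
  have h2 := Finset.sum_nonneg fun r (_ : r ∈ Finset.univ) => h1 r
  rw [Finset.sum_comm] at h2
  -- The seller events partition the histories, so each history contributes to one recommendation
  -- only.
  have h3 : ∀ x : Terminal R, ∑ r : G.Offer,
      (sellerEvent R r).indicator (onPath R μ) x * sellerGain a x.rule.1 x.state
      = onPath R μ x * ((x.rule.1.1 x.state : ℝ) *
          acc (x.rule.1.2 (x.rule.1.1 x.state) x.state) - a) := by
    intro x
    rw [Finset.sum_eq_single (x.rule.1.1 x.state)]
    · rw [Set.indicator_of_mem (show x ∈ sellerEvent R _ from rfl), sellerGain, hacc]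
      simp [acc]
    · intro r _ hr
      rw [Set.indicator_of_notMem (s := sellerEvent R r) (fun hx => hr (Eq.symm hx)), zero_mul]
    · simp
  simp only [h3] at h2
  rw [hc.sum_onPath_eq hμ fun f _ ω => (f.1 ω : ℝ) * acc (f.2 (f.1 ω) ω) - a] at h2
  simp only [mul_sub, Finset.sum_sub_distrib] at h2
  have h4 : ∑ f : G.FeedbackRule, ∑ ω : G.State, μ f * G.prior ω * (a : ℝ) = a := by
    simp only [← Finset.sum_mul, ← Finset.mul_sum, G.prior_sum, mul_one, hμ.2, one_mul]
  rw [h4] at h2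
  exact sub_nonneg.1 h2

/-- Only obedience to acceptance is used: rejections contribute nothing to the payoff. -/
theorem buyerPayoff_nonneg [Nonempty G.State] {μ : G.FeedbackRule → ℝ} (h : G.IsSBCE μ) :
    0 ≤ G.buyerPayoff μ := by
  obtain ⟨hμ, R, β, -, hb, hc⟩ := h
  have h1 : ∀ a : G.Offer, 0 ≤ ∑ x : Terminal R,
      (buyerEvent R a true).indicator (onPath R μ) x * buyerGain a x.rule.1 x.state := by
    intro a
    by_cases hr : true ∈ R.buyer a
    · rw [← hc.prob_eq_onPath]
      exact β.sum_indicator_nonneg (buyerEvent_nonempty hr) _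
        ((buyerObedient_iff β).1 hb a true hr)
    · refine Finset.sum_nonneg fun x _ => ?_
      have : x ∉ buyerEvent R a true := fun hx => hr (hx.2 ▸ x.rule.2.2 a x.state)
      simp [this]
  have h2 := Finset.sum_nonneg fun r (_ : r ∈ Finset.univ) => h1 r
  rw [Finset.sum_comm] at h2
  have h3 : ∀ x : Terminal R, ∑ a : G.Offer,
      (buyerEvent R a true).indicator (onPath R μ) x * buyerGain a x.rule.1 x.state
      = onPath R μ x * (((x.state : ℝ) - x.offer) * acc (x.rule.1.2 x.offer x.state)) := by
    intro x
    rw [Finset.sum_eq_single x.offer]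
    · cases hx : x.rule.1.2 x.offer x.state
      · rw [Set.indicator_of_notMem (fun h => Bool.false_ne_true (hx.symm.trans h.2))]
        simp [acc]
      · rw [Set.indicator_of_mem (show x ∈ buyerEvent R _ _ from ⟨rfl, hx⟩), buyerGain, hx]
        simp [acc]
    · intro r _ hr
      rw [Set.indicator_of_notMem (fun hx => hr hx.1.symm), zero_mul]
    · simp
  simp only [h3] at h2
  rwa [hc.sum_onPath_eq hμ fun f a ω => ((ω : ℝ) - a) * acc (f.2 a ω)] at h2

theorem buyerPayoff_add_sellerPayoff_le {μ : G.FeedbackRule → ℝ}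
    (hμ : μ ∈ stdSimplex ℝ G.FeedbackRule) :
    G.buyerPayoff μ + G.sellerPayoff μ ≤ G.mean := by
  have : G.mean = ∑ f : G.FeedbackRule, ∑ ω : G.State, μ f * G.prior ω * (ω : ℝ) := by
    simp only [mul_assoc, ← Finset.mul_sum, ← Finset.sum_mul, hμ.2, one_mul, mean]
  rw [this, buyerPayoff, sellerPayoff]
  simp only [← Finset.sum_add_distrib]
  refine Finset.sum_le_sum fun f _ => Finset.sum_le_sum fun ω _ => ?_
  rw [← mul_add]
  refine mul_le_mul_of_nonneg_left ?_ (mul_nonneg (hμ.1 f) (G.prior_pos ω).le)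
  have h1 := acc_le_one (f.2 (f.1 ω) ω)
  have h2 := G.states_pos ω ω.2
  nlinarith

/-! ### Construction of equilibria -/

/-- The rule that recommends the offer `o` in every state, acceptance of the offers up to `lo`,
the reply `t` to the offer `hi`, and rejection of all other offers. -/
noncomputable def posted (lo hi o : G.Offer) (t : Bool) : G.FeedbackRule :=
  (fun _ => o, fun a _ => if a ≤ lo then true else if a = hi then t else false)

/-- The offers `lo` and `hi` may be recommended; offers up to `lo` are accepted, both replies to
`hi` are possible, other offers are rejected. -/
noncomputable def postedRange (lo hi : G.Offer) : G.MediationRange where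
  seller := {lo, hi}
  seller_nonempty := ⟨lo, by simp⟩
  buyer a := if a ≤ lo then {true} else if a = hi then Set.univ else {false}
  buyer_nonempty a := by split_ifs <;> simp

theorem posted_mem (lo hi : G.Offer) {o : G.Offer} (t : Bool) (ho : o = lo ∨ o = hi) :
    (∀ ω, (posted lo hi o t).1 ω ∈ (postedRange lo hi).seller) ∧
      ∀ a ω, (posted lo hi o t).2 a ω ∈ (postedRange lo hi).buyer a := by
  refine ⟨fun _ => ho, fun a ω => ?_⟩
  simp only [posted, postedRange]
  split_ifs <;> simp

/-- The weights `cA`, `cB`, `cC` on the rules "offer `lo`", "offer `hi`, to be accepted" and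
"offer `hi`, to be rejected". -/
noncomputable def ruleWeight (lo hi : G.Offer) (cA cB cC : ℝ) (f : G.FeedbackRule) : ℝ :=
  (if f = posted lo hi lo false then cA else 0) + (if f = posted lo hi hi true then cB else 0)
    + (if f = posted lo hi hi false then cC else 0)

theorem ruleWeight_nonneg (lo hi : G.Offer) {cA cB cC : ℝ} (hA : 0 ≤ cA) (hB : 0 ≤ cB)
    (hC : 0 ≤ cC) (f : G.FeedbackRule) : 0 ≤ ruleWeight lo hi cA cB cC f := by
  unfold ruleWeight
  positivity

theorem ruleWeight_pos {lo hi : G.Offer} {cA cB cC : ℝ} (hA : 0 < cA) (hB : 0 < cB)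
    (hC : 0 < cC) {f : G.FeedbackRule} (hf : f = posted lo hi lo false ∨
      f = posted lo hi hi true ∨ f = posted lo hi hi false) :
    0 < ruleWeight lo hi cA cB cC f := by
  unfold ruleWeight
  rcases hf with hf | hf | hf <;> rw [if_pos hf] <;> positivity

theorem sum_ruleWeight (lo hi : G.Offer) (cA cB cC : ℝ) (g : G.FeedbackRule → ℝ) :
    ∑ f : G.FeedbackRule, ruleWeight lo hi cA cB cC f * g f
      = cA * g (posted lo hi lo false) + cB * g (posted lo hi hi true)
        + cC * g (posted lo hi hi false) := by
  simp [ruleWeight, add_mul, Finset.sum_add_distrib]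

theorem sum_ruleIn_ite {f₀ : G.FeedbackRule}
    (h : (∀ ω, f₀.1 ω ∈ R.seller) ∧ ∀ a ω, f₀.2 a ω ∈ R.buyer a) (c : ℝ)
    (g : G.FeedbackRule → ℝ) :
    ∑ f : RuleIn R, (if f.1 = f₀ then c else 0) * g f.1 = c * g f₀ := by
  rw [Finset.sum_eq_single (⟨f₀, h⟩ : RuleIn R)]
  · simp
  · intro f _ hf
    rw [if_neg fun h' => hf (Subtype.ext h'), zero_mul]
  · simp

theorem sum_ruleIn_ruleWeight (lo hi : G.Offer) (cA cB cC : ℝ) (g : G.FeedbackRule → ℝ) :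
    ∑ f : RuleIn (postedRange lo hi), ruleWeight lo hi cA cB cC f.1 * g f.1
      = cA * g (posted lo hi lo false) + cB * g (posted lo hi hi true)
        + cC * g (posted lo hi hi false) := by
  simp only [ruleWeight, add_mul, Finset.sum_add_distrib]
  rw [sum_ruleIn_ite (posted_mem lo hi _ (Or.inl rfl)),
    sum_ruleIn_ite (posted_mem lo hi _ (Or.inr rfl)),
    sum_ruleIn_ite (posted_mem lo hi _ (Or.inr rfl))]

theorem sum_onPath_ruleWeight (lo hi : G.Offer) (cA cB cC : ℝ)
    (g : G.FeedbackRule → G.Offer → G.State → ℝ) :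
    ∑ x : Terminal (postedRange lo hi), onPath _ (ruleWeight lo hi cA cB cC) x *
        g x.rule.1 x.offer x.state
      = cA * ∑ ω, G.prior ω * g (posted lo hi lo false) lo ω
        + cB * ∑ ω, G.prior ω * g (posted lo hi hi true) hi ω
        + cC * ∑ ω, G.prior ω * g (posted lo hi hi false) hi ω := by
  rw [sum_onPath]
  simp only [mul_assoc, ← Finset.mul_sum]
  exact sum_ruleIn_ruleWeight lo hi cA cB cC fun f => ∑ ω, G.prior ω * g f (f.1 ω) ω

theorem sum_prior_mul_const (k : ℝ) : ∑ ω, G.prior ω * k = k := by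
  rw [← Finset.sum_mul, G.prior_sum, one_mul]

theorem sum_prior_mul_sub (a : ℝ) : ∑ ω : G.State, G.prior ω * ((ω : ℝ) - a) = G.mean - a := by
  simp only [mul_sub, Finset.sum_sub_distrib, sum_prior_mul_const, mean]

theorem posted_snd_lo (lo hi o : G.Offer) (t : Bool) {a : G.Offer} (ha : a ≤ lo) (ω : G.State) :
    (posted lo hi o t).2 a ω = true := if_pos ha

theorem posted_snd_hi {lo hi : G.Offer} (h : lo < hi) (o : G.Offer) (t : Bool) (ω : G.State) :
    (posted lo hi o t).2 hi ω = t := by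
  simp [posted, h]

theorem posted_snd_other {lo hi a : G.Offer} (ha : ¬ a ≤ lo) (h : a ≠ hi) (o : G.Offer)
    (t : Bool) (ω : G.State) : (posted lo hi o t).2 a ω = false := by
  simp only [posted, if_neg ha, if_neg h]

variable {lo hi : G.Offer} {cA cB cC : ℝ}

/-- On the path of play the seller gains from obeying. -/
theorem seller_onPath_nonneg (h : lo < hi) (hA : 0 ≤ cA) (hB : 0 ≤ cB) (hC : 0 ≤ cC)
    (hBC : (cB + cC) * lo ≤ cB * hi) (r a : G.Offer) :
    0 ≤ ∑ x : Terminal (postedRange lo hi),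
      (sellerEvent _ r).indicator (onPath _ (ruleWeight lo hi cA cB cC)) x *
        sellerGain a x.rule.1 x.state := by
  have h0 : (0 : ℝ) ≤ lo := G.offers_nonneg lo lo.2
  have hlt : (lo : ℝ) < hi := h
  have h1 : ∀ x : Terminal (postedRange lo hi),
      (sellerEvent _ r).indicator (onPath _ (ruleWeight lo hi cA cB cC)) x *
        sellerGain a x.rule.1 x.state
      = onPath _ (ruleWeight lo hi cA cB cC) x *
        (if x.rule.1.1 x.state = r then sellerGain a x.rule.1 x.state else 0) := by
    intro x
    by_cases hx : x.rule.1.1 x.state = r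
    · rw [Set.indicator_of_mem (s := sellerEvent _ r) hx, if_pos hx]
    · rw [Set.indicator_of_notMem (s := sellerEvent _ r) hx, if_neg hx, zero_mul, mul_zero]
  simp only [h1]
  rw [sum_onPath_ruleWeight lo hi cA cB cC
    fun f _ ω => if f.1 ω = r then sellerGain a f ω else 0]
  have e1 : ∀ o t (ω : G.State), (posted lo hi o t).1 ω = o := fun _ _ _ => rfl
  have e2 : ∀ t (ω : G.State), (posted lo hi lo t).2 lo ω = true := fun t ω =>
    posted_snd_lo lo hi lo t le_rfl ω
  simp only [sellerGain, e1, e2, posted_snd_hi h]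
  have hh : (0 : ℝ) ≤ hi := h0.trans hlt.le
  by_cases hlr : lo = r
  · have hhr : hi ≠ r := fun hr => h.ne (hlr.trans hr.symm)
    simp only [if_pos hlr, if_neg hhr, mul_zero, Finset.sum_const_zero, add_zero]
    refine mul_nonneg hA (Finset.sum_nonneg fun ω _ => mul_nonneg (G.prior_pos ω).le ?_)
    -- A lower offer sells for less, and any higher one, `hi` included, is rejected under this rule.
    rcases le_or_gt a lo with ha | ha
    · have ha' : (a : ℝ) ≤ lo := ha
      simpa [posted_snd_lo lo hi _ _ ha, acc] using ha'
    · have : (posted lo hi lo false).2 a ω = false := by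
        simp [posted, ha]
      simpa [this, acc] using h0
  · simp only [if_neg hlr, mul_zero, Finset.sum_const_zero, zero_add]
    by_cases hhr : hi = r
    · simp only [if_pos hhr]
      rcases le_or_gt a lo with ha | ha
      · have ha' : (a : ℝ) ≤ lo := ha
        simp only [posted_snd_lo lo hi _ _ ha, sum_prior_mul_const, acc, if_true,
          Bool.false_eq_true, if_false]
        -- The deviation sells for sure and earns (cB + cC) a ≤ (cB + cC) lo ≤ cB hi.
        nlinarith
      · by_cases hah : a = hi
        · subst hah
          simp [posted_snd_hi h]
        · simp only [posted_snd_other (not_le.2 ha) hah, sum_prior_mul_const, acc, if_true,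
            Bool.false_eq_true, if_false]
          nlinarith
    · simp [hhr]

/-- On the path of play the buyer does not lose from obeying. -/
theorem buyer_onPath_nonneg (h : lo < hi) (hlo : (lo : ℝ) ≤ G.mean) (hhi : (hi : ℝ) = G.mean)
    (hA : 0 ≤ cA) (a : G.Offer) (b : Bool) :
    0 ≤ ∑ x : Terminal (postedRange lo hi),
      (buyerEvent _ a b).indicator (onPath _ (ruleWeight lo hi cA cB cC)) x *
        buyerGain a x.rule.1 x.state := by
  have h1 : ∀ x : Terminal (postedRange lo hi),
      (buyerEvent _ a b).indicator (onPath _ (ruleWeight lo hi cA cB cC)) x *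
        buyerGain a x.rule.1 x.state
      = onPath _ (ruleWeight lo hi cA cB cC) x *
        (if x.offer = a ∧ x.rule.1.2 a x.state = b then
          ((x.state : ℝ) - a) * (2 * acc (x.rule.1.2 a x.state) - 1) else 0) := by
    intro x
    by_cases hx : x.offer = a ∧ x.rule.1.2 a x.state = b
    · rw [Set.indicator_of_mem (s := buyerEvent _ a b) hx, if_pos hx, buyerGain]
      ring
    · rw [Set.indicator_of_notMem (s := buyerEvent _ a b) hx, if_neg hx, zero_mul, mul_zero]
  simp only [h1]
  rw [sum_onPath_ruleWeight lo hi cA cB cC fun f o ω =>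
    if o = a ∧ f.2 a ω = b then ((ω : ℝ) - a) * (2 * acc (f.2 a ω) - 1) else 0]
  -- The reply to `hi` is independent of the state and `hi` is the prior mean, so the buyer's gain
  -- averages to zero.
  have hzero : ∀ t, ∑ ω : G.State, G.prior ω *
      (if hi = a ∧ (posted lo hi hi t).2 a ω = b then
        ((ω : ℝ) - a) * (2 * acc ((posted lo hi hi t).2 a ω) - 1) else 0) = 0 := by
    intro t
    by_cases ha : hi = a
    · subst ha
      simp only [posted_snd_hi h]
      by_cases hb : t = b
      · simp only [hb, and_self, if_true, ← mul_assoc, ← Finset.sum_mul, sum_prior_mul_sub, hhi,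
          sub_self, zero_mul]
      · simp [hb]
    · simp [ha]
  rw [hzero, hzero, mul_zero, mul_zero, add_zero, add_zero]
  refine mul_nonneg hA ?_
  by_cases ha : lo = a
  · subst ha
    simp only [posted_snd_lo lo hi _ _ le_rfl]
    by_cases hb : true = b
    · simp only [hb, and_self, if_true, ← mul_assoc, ← Finset.sum_mul, sum_prior_mul_sub]
      subst hb
      simpa [acc] using by linarith
    · simp [hb]
  · simp [ha]

/-! ### Off-path beliefs and obedience. -/

/-- Weights on terminal histories, from the path of play with rule weights `c` to ever less
likely trembles. Offers off the path come first from the state `ωL`. -/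
noncomputable def tremble (lo hi : G.Offer) (ωL : G.State) (c : G.FeedbackRule → ℝ) :
    ℕ → Terminal (postedRange lo hi) → ℝ
  | 0 => onPath _ c
  -- All three rules get positive weight, so every seller recommendation and both replies to `hi`
  -- are charged even if `c` omits them. The seller's condition (hi + hi - lo) lo ≤ hi² is (hi -
  -- lo)² ≥ 0.
  | 1 => onPath _ (ruleWeight lo hi 1 hi (hi - lo))
  | 2 => fun x => if x.rule.1.2 x.offer x.state = x.reply ∧ x.state = ωL then 1 else 0
  -- Charges every offer and state while keeping the reply obedient, as the second consistency
  -- equation needs; only the next level lets the buyer disobey.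
  | 3 => fun x => if x.rule.1.2 x.offer x.state = x.reply then 1 else 0
  | _ => fun _ => 1

variable {ωL : G.State} {c : G.FeedbackRule → ℝ}

theorem tremble_nonneg (h : lo < hi) (hc : ∀ f, 0 ≤ c f) (i : ℕ)
    (x : Terminal (postedRange lo hi)) : 0 ≤ tremble lo hi ωL c i x := by
  have h0 : (0 : ℝ) ≤ hi := G.offers_nonneg hi hi.2
  have hlt : (lo : ℝ) < hi := h
  match i with
  | 0 => exact onPath_nonneg hc x
  | 1 => exact onPath_nonneg (ruleWeight_nonneg lo hi zero_le_one h0 (by linarith)) x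
  | 2 => simp only [tremble]; split_ifs <;> norm_num
  | 3 => simp only [tremble]; split_ifs <;> norm_num
  | _ + 4 => exact zero_le_one

theorem tremble_eq_zero {i : ℕ} (hi3 : i ≤ 3) {x : Terminal (postedRange lo hi)}
    (hx : x.rule.1.2 x.offer x.state ≠ x.reply) : tremble lo hi ωL c i x = 0 := by
  have key : ∀ c, onPath (postedRange lo hi) c x = 0 := fun c => by
    rw [onPath, if_neg, mul_zero]
    rintro ⟨h1, h2⟩
    exact hx (by rw [h1] at h2; exact h2)
  interval_cases i
  · exact key _
  · exact key _
  · simp [tremble, hx]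
  · simp [tremble, hx]

/-- The beliefs that support the mechanism with rule weights `c`. -/
noncomputable def trembleSystem (lo hi : G.Offer) (ωL : G.State) (h : lo < hi)
    (c : G.FeedbackRule → ℝ) (hc : ∀ f, 0 ≤ c f) : CondProbSystem (Terminal (postedRange lo hi)) :=
  CondProbSystem.lexicographic (tremble lo hi ωL c) (tremble_nonneg h hc) 4 fun _ => one_pos

theorem trembleSystem_prob (h : lo < hi) (hc : ∀ f, 0 ≤ c f)
    (A Z : Set (Terminal (postedRange lo hi))) :
    (trembleSystem lo hi ωL h c hc).prob A Z =
      mass (tremble lo hi ωL c (CondProbSystem.level (tremble lo hi ωL c) Z)) (A ∩ Z) /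
        mass (tremble lo hi ωL c (CondProbSystem.level (tremble lo hi ωL c) Z)) Z := rfl

theorem mass_onPath_ruleWeight :
    mass (onPath (postedRange lo hi) (ruleWeight lo hi cA cB cC)) Set.univ = cA + cB + cC := by
  have := sum_onPath_ruleWeight lo hi cA cB cC fun _ _ _ => 1
  simp only [mul_one, G.prior_sum] at this
  simpa only [mass, Set.indicator_univ] using this

/-- Level 0 has total mass one, which gives the first equation. For the second, the conditioning
event is charged by level 3 at the latest, and up to there replies are obedient, so the rule, offer
and state determine the reply. -/
theorem trembleSystem_consistent (h : lo < hi) (hc : ∀ f, 0 ≤ ruleWeight lo hi cA cB cC f)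
    (hsum : cA + cB + cC = 1) :
    Consistent _ (ruleWeight lo hi cA cB cC) (trembleSystem lo hi ωL h _ hc) := by
  intro f a b ω
  simp only [trembleSystem_prob]
  constructor
  · have hm : mass (tremble lo hi ωL (ruleWeight lo hi cA cB cC) 0) Set.univ = 1 := by
      rw [← hsum]
      exact mass_onPath_ruleWeight
    have hl := Nat.le_zero.1 (CondProbSystem.level_le (hm.symm ▸ zero_lt_one))
    rw [hl, hm, div_one, mass_singleton_inter, Set.indicator_univ]
    rfl
  · set Z : Set (Terminal (postedRange lo hi)) :=
      {x | x.rule.1.1 = f.1.1 ∧ x.offer = a ∧ x.state = ω}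
    set m := tremble lo hi ωL (ruleWeight lo hi cA cB cC) with hm_def
    have h3 : 0 < mass (m 3) Z :=
      mass_pos (x := ⟨f, a, f.1.2 a ω, ω⟩) (tremble_nonneg h hc 3) ⟨rfl, rfl, rfl⟩
        (by simp [tremble])
    have hl := CondProbSystem.level_le h3
    set i := CondProbSystem.level m Z
    have hmem : (⟨f, a, b, ω⟩ : Terminal (postedRange lo hi)) ∈ Z := ⟨rfl, rfl, rfl⟩
    by_cases hb : f.1.2 a ω = b
    · have key : mass (m i) ({x | x.rule = f} ∩ Z) = m i ⟨f, a, b, ω⟩ := by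
        rw [mass, Finset.sum_eq_single (⟨f, a, b, ω⟩ : Terminal (postedRange lo hi))]
        · exact Set.indicator_of_mem (s := {x | x.rule = f} ∩ Z)
            (Set.mem_inter rfl hmem) (m i)
        · rintro ⟨f', a', b', ω'⟩ _ hne
          refine Set.indicator_apply_eq_zero.2 ?_
          rintro ⟨h1, -, h2, h4⟩
          obtain rfl : f' = f := h1
          obtain rfl : a' = a := h2
          obtain rfl : ω' = ω := h4
          refine tremble_eq_zero hl fun hb' => hne ?_
          simp only at hb'
          rw [← hb', hb]
        · simp
      rw [if_pos hb, mul_one, mass_singleton_inter,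
        Set.indicator_of_mem (s := Z) hmem, key]
    · rw [if_neg hb, mul_zero, mass_singleton_inter,
        Set.indicator_of_mem (s := Z) hmem, hm_def,
        tremble_eq_zero hl hb, zero_div]

theorem trembleSystem_sellerObedient (h : lo < hi) (hA : 0 ≤ cA) (hB : 0 ≤ cB) (hC : 0 ≤ cC)
    (hBC : (cB + cC) * lo ≤ cB * hi) :
    SellerObedient _ (trembleSystem lo hi ωL h _ (ruleWeight_nonneg lo hi hA hB hC)) := by
  have : Nonempty G.State := ⟨ωL⟩
  have h0 : (0 : ℝ) ≤ lo := G.offers_nonneg lo lo.2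
  have hlt : (lo : ℝ) < hi := h
  have hnn := tremble_nonneg (ωL := ωL) h (ruleWeight_nonneg lo hi hA hB hC)
  rw [sellerObedient_iff]
  intro r hr a
  refine CondProbSystem.lexicographic_expect_nonneg 1 ?_ fun i hi1 => ?_
  · rcases hr with rfl | rfl
    · exact mass_pos (hnn 1) (x := ⟨⟨_, posted_mem r hi false (Or.inl rfl)⟩, _, _, ωL⟩) rfl
        (onPath_pos (ruleWeight_pos one_pos (h0.trans_lt hlt) (sub_pos.2 hlt) (Or.inl rfl)) ωL)
    · exact mass_pos (hnn 1) (x := ⟨⟨_, posted_mem lo r true (Or.inr rfl)⟩, _, _, ωL⟩) rfl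
        (onPath_pos (ruleWeight_pos one_pos (h0.trans_lt hlt) (sub_pos.2 hlt)
          (Or.inr (Or.inl rfl))) ωL)
  · interval_cases i
    · exact seller_onPath_nonneg h hA hB hC hBC r a
    · exact seller_onPath_nonneg h zero_le_one (by linarith) (by linarith) (by nlinarith) r a

/-- Replies to `hi` are settled by level 1. Any other offer is settled by level 2, where the state
is ω_L: accepting is right up to `lo` and rejecting is right above it. -/
theorem trembleSystem_buyerObedient (h : lo < hi) (hhi : (hi : ℝ) = G.mean)
    (hL : ∀ a : G.Offer, ¬ a ≤ lo → (ωL : ℝ) ≤ a) (hloL : (lo : ℝ) ≤ ωL)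
    (hA : 0 ≤ cA) (hB : 0 ≤ cB) (hC : 0 ≤ cC) :
    BuyerObedient _ (trembleSystem lo hi ωL h _ (ruleWeight_nonneg lo hi hA hB hC)) := by
  have : Nonempty G.State := ⟨ωL⟩
  have hlt : (lo : ℝ) < hi := h
  have hnn := tremble_nonneg (ωL := ωL) h (ruleWeight_nonneg lo hi hA hB hC)
  rw [buyerObedient_iff]
  intro a b hb
  have h01 : ∀ i ≤ 1, 0 ≤ ∑ x : Terminal (postedRange lo hi),
      (buyerEvent _ a b).indicator (tremble lo hi ωL (ruleWeight lo hi cA cB cC) i) x *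
        buyerGain a x.rule.1 x.state := by
    intro i hi1
    interval_cases i
    · exact buyer_onPath_nonneg h (by linarith) hhi hA a b
    · exact buyer_onPath_nonneg h (by linarith) hhi zero_le_one a b
  by_cases hah : a = hi
  · refine CondProbSystem.lexicographic_expect_nonneg 1 ?_ h01
    subst hah
    have h0 : (0 : ℝ) ≤ lo := G.offers_nonneg lo lo.2
    refine mass_pos (hnn 1) (x := ⟨⟨_, posted_mem lo a b (Or.inr rfl)⟩, _, _, ωL⟩)
      ⟨rfl, posted_snd_hi h a b ωL⟩ (onPath_pos (ruleWeight_pos one_pos (h0.trans_lt hlt)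
        (sub_pos.2 hlt) (Or.inr ?_)) ωL)
    cases b
    · exact Or.inr rfl
    · exact Or.inl rfl
  · refine CondProbSystem.lexicographic_expect_nonneg 2 ?_ fun i hi2 => ?_
    · obtain ⟨f, hf⟩ := exists_rule_reply hb
      exact mass_pos (hnn 2) (x := ⟨f, a, b, ωL⟩) ⟨rfl, hf ωL⟩ (by simp [tremble, hf])
    · rcases Nat.lt_or_ge i 2 with hi1 | hi1
      · exact h01 i (by omega)
      · obtain rfl : i = 2 := le_antisymm hi2 hi1
        refine Finset.sum_nonneg fun x _ => ?_
        by_cases hx : x ∈ buyerEvent _ a b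
        · rw [Set.indicator_of_mem hx]
          by_cases hxL : x.state = ωL
          · refine mul_nonneg (hnn 2 x) ?_
            rw [buyerGain, hx.2, hxL]
            simp only [postedRange] at hb
            by_cases ha : a ≤ lo
            · rw [if_pos ha] at hb
              rw [Set.mem_singleton_iff.1 hb]
              have : (a : ℝ) ≤ lo := ha
              simp only [acc, if_true]
              linarith
            · rw [if_neg ha, if_neg hah] at hb
              rw [Set.mem_singleton_iff.1 hb]
              simpa [acc] using hL a ha
          · simp [tremble, hxL]
        · rw [Set.indicator_of_notMem hx, zero_mul]

theorem isSBCE_ruleWeight (h : lo < hi) (hhi : (hi : ℝ) = G.mean)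
    (hL : ∀ a : G.Offer, ¬ a ≤ lo → (ωL : ℝ) ≤ a) (hloL : (lo : ℝ) ≤ ωL)
    (hA : 0 ≤ cA) (hB : 0 ≤ cB) (hC : 0 ≤ cC) (hsum : cA + cB + cC = 1)
    (hBC : (cB + cC) * lo ≤ cB * hi) : G.IsSBCE (ruleWeight lo hi cA cB cC) := by
  refine ⟨⟨ruleWeight_nonneg lo hi hA hB hC, ?_⟩, postedRange lo hi,
    trembleSystem lo hi ωL h _ (ruleWeight_nonneg lo hi hA hB hC),
    trembleSystem_sellerObedient h hA hB hC hBC,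
    trembleSystem_buyerObedient h hhi hL hloL hA hB hC,
    trembleSystem_consistent h _ hsum⟩
  have := sum_ruleWeight lo hi cA cB cC fun _ => 1
  simpa [hsum] using this

/-! ### Payoffs of the mixtures and the triangle. -/

theorem buyerPayoff_ruleWeight (h : lo < hi) (hhi : (hi : ℝ) = G.mean) :
    G.buyerPayoff (ruleWeight lo hi cA cB cC) = cA * (G.mean - lo) := by
  simp only [buyerPayoff, mul_assoc, ← Finset.mul_sum]
  rw [sum_ruleWeight lo hi cA cB cC fun f =>
    ∑ ω : G.State, G.prior ω * (((ω : ℝ) - f.1 ω) * acc (f.2 (f.1 ω) ω))]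
  have e1 : ∀ o t (ω : G.State), (posted lo hi o t).1 ω = o := fun _ _ _ => rfl
  simp only [e1, posted_snd_hi h, posted_snd_lo lo hi _ _ le_rfl, acc, if_true, mul_one,
    sum_prior_mul_sub, hhi]
  simp

theorem sellerPayoff_ruleWeight (h : lo < hi) :
    G.sellerPayoff (ruleWeight lo hi cA cB cC) = cA * lo + cB * hi := by
  simp only [sellerPayoff, mul_assoc, ← Finset.mul_sum]
  rw [sum_ruleWeight lo hi cA cB cC fun f =>
    ∑ ω : G.State, G.prior ω * ((f.1 ω : ℝ) * acc (f.2 (f.1 ω) ω))]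
  have e1 : ∀ o t (ω : G.State), (posted lo hi o t).1 ω = o := fun _ _ _ => rfl
  simp only [e1, posted_snd_hi h, posted_snd_lo lo hi _ _ le_rfl, acc, if_true, mul_one,
    sum_prior_mul_const]
  simp

theorem convexHull_triangle {l m : ℝ} (h : l < m) :
    convexHull ℝ {((0 : ℝ), l), ((0 : ℝ), m), (m - l, l)}
      = {v : ℝ × ℝ | 0 ≤ v.1 ∧ l ≤ v.2 ∧ v.1 + v.2 ≤ m} := by
  apply Set.Subset.antisymm
  · refine convexHull_min ?_ ?_
    · rintro v (rfl | rfl | rfl)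
      · exact ⟨le_rfl, le_rfl, by simpa using h.le⟩
      · exact ⟨le_rfl, h.le, by simp⟩
      · exact ⟨by simpa using h.le, le_rfl, by simp⟩
    · rintro ⟨x, y⟩ ⟨h1, h2, h3⟩ ⟨x', y'⟩ ⟨h1', h2', h3'⟩ s t hs ht hst
      obtain rfl : t = 1 - s := by linarith
      simp only at h1 h2 h3 h1' h2' h3'
      refine ⟨?_, ?_, ?_⟩ <;> simp only [Prod.smul_mk, Prod.mk_add_mk, smul_eq_mul]
      · positivity
      · nlinarith
      · nlinarith
  · rintro ⟨u, s⟩ ⟨h1, h2, h3⟩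
    simp only at h1 h2 h3
    have hd : 0 < m - l := sub_pos.2 h
    -- The weights are the barycentric coordinates of the point.
    refine mem_convexHull_of_exists_fintype
      ![(m - u - s) / (m - l), (s - l) / (m - l), u / (m - l)]
      ![((0 : ℝ), l), ((0 : ℝ), m), (m - l, l)] ?_ ?_ ?_ ?_
    · intro i
      fin_cases i
      · exact div_nonneg (by linarith) hd.le
      · exact div_nonneg (by linarith) hd.le
      · exact div_nonneg h1 hd.le
    · simp only [Fin.sum_univ_three, Matrix.cons_val]
      field_simp
      ring
    · intro i
      fin_cases i <;> simp
    · simp only [Fin.sum_univ_three, Matrix.cons_val, Prod.smul_mk, Prod.mk_add_mk, smul_eq_mul,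
        Prod.mk.injEq]
      constructor
      · field_simp
        ring
      · field_simp
        ring

end

end BargainingGame

theorem proposition1 (G : BargainingGame) (ωL ωLm : ℝ)
    (hL : IsLeast {ω : ℝ | ω ∈ G.states} ωL)
    (hLm : IsGreatest {a : ℝ | a ∈ G.offers ∧ a < ωL} ωLm)
    (hE : G.mean ∈ G.offers) :
    G.sbcePayoffs =
      convexHull ℝ {((0 : ℝ), ωLm), ((0 : ℝ), G.mean), (G.mean - ωLm, ωLm)} := by
  obtain ⟨hLs, hLle⟩ := hL
  obtain ⟨⟨hlo, hloL⟩, hmax⟩ := hLm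
  have : Nonempty G.State := ⟨⟨ωL, hLs⟩⟩
  have hLE : ωL ≤ G.mean := by
    rw [← BargainingGame.sum_prior_mul_const (G := G) ωL]
    exact Finset.sum_le_sum fun ω _ =>
      mul_le_mul_of_nonneg_left (hLle ω.2) (G.prior_pos ω).le
  have hlt : ωLm < G.mean := hloL.trans_le hLE
  have h0 : 0 ≤ ωLm := G.offers_nonneg _ hlo
  rw [BargainingGame.convexHull_triangle hlt]
  apply Set.Subset.antisymm
  · rintro v ⟨μ, hμ, rfl⟩
    exact ⟨BargainingGame.buyerPayoff_nonneg hμ,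
      BargainingGame.le_sellerPayoff hμ (a := ⟨ωLm, hlo⟩) fun ω => hloL.trans_le (hLle ω.2),
      BargainingGame.buyerPayoff_add_sellerPayoff_le hμ.1⟩
  · rintro ⟨u, s⟩ ⟨h1, h2, h3⟩
    simp only at h1 h2 h3
    have hd : 0 < G.mean - ωLm := sub_pos.2 hlt
    have hm : 0 < G.mean := h0.trans_lt hlt
    -- The weights solve the two payoff equations; multiplied by the mean, the remaining weight 1 -
    -- cA - cB is the lost surplus E(ω) - u - s.
    obtain ⟨cA, hcA⟩ : ∃ c, c * (G.mean - ωLm) = u := ⟨u / (G.mean - ωLm), by field_simp⟩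
    obtain ⟨cB, hcB⟩ : ∃ c, c * G.mean = s - cA * ωLm :=
      ⟨(s - cA * ωLm) / G.mean, by field_simp⟩
    have hA : 0 ≤ cA := nonneg_of_mul_nonneg_left (hcA.symm ▸ h1) hd
    have hA1 : cA ≤ 1 := by
      by_contra hgt
      nlinarith
    have hB : 0 ≤ cB := by
      refine nonneg_of_mul_nonneg_left (b := G.mean) ?_ hm
      rw [hcB]
      nlinarith
    have hC : 0 ≤ 1 - cA - cB := by
      refine nonneg_of_mul_nonneg_left (b := G.mean) ?_ hm
      nlinarith
    have hlo_hi : (⟨ωLm, hlo⟩ : G.Offer) < ⟨G.mean, hE⟩ := hlt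
    refine ⟨BargainingGame.ruleWeight ⟨ωLm, hlo⟩ ⟨G.mean, hE⟩ cA cB (1 - cA - cB),
      BargainingGame.isSBCE_ruleWeight (ωL := ⟨ωL, hLs⟩) hlo_hi rfl ?_ hloL.le hA hB hC
        (by ring) ?_, ?_⟩
    · intro a ha
      by_contra hlt'
      -- Maximality of ω_L⁻ leaves no offer strictly between it and ω_L, so rejecting above it is
      -- justified at ω_L.
      exact ha (hmax ⟨a.2, not_le.1 hlt'⟩)
    · simp only
      linarith
    · rw [BargainingGame.buyerPayoff_ruleWeight hlo_hi rfl,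
        BargainingGame.sellerPayoff_ruleWeight hlo_hi, hcA, hcB]
      simp
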